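/- Let $\Xi$ be a countable set, $\widetilde\pi$ a probability distribution on $\Xi$ and $\widetilde Q$ a Markov transition kernel on $\Xi$ such that (i) $\widetilde\pi(\xi)>0$ for all $\xi$; (ii) $\widetilde Q(\xi,\xi')\neq 0 \iff \widetilde Q(\xi',\xi)\neq 0$; (iii) $\widetilde Q$ is irreducible. Let $\mathcal E=\{(\xi,\xi'):\widetilde Q(\xi,\xi')>0\}$. Let $\mathcal G_i^+=(\mathcal V_i,\mathcal E_i^+)$, $i=1,\dots,n$, be directed graphs with $\mathcal V_i\subseteq\Xi$, with nonempty edge sets and no isolated vertices, and put $\mathcal E_i^-=\{(u,v):(v,u)\in\mathcal E_i^+\}$. Assume that $\mathcal E_i^+\cap\mathcal E_i^-=\emptyset$, that $\bigcup_i\mathcal V_i=\Xi$ and $\bigcup_i(\mathcal E_i^+\cup\mathcal E_i^-)=\mathcal E$. Put $\mathcal N_i^{\pm1}(\xi)=\{\xi':(\xi,\xi')\in\mathcal E_i^{\pm}\}$ and $\widetilde\omega_i(\xi)=\widetilde Q(\xi,\mathcal N_i^{+1}(\xi))+\widetilde Q(\xi,\mathcal N_i^{-1}(\xi))$, and assume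 $\sum_{i=1}^n\widetilde\omega_i(\xi)=1$ for every $\xi$. Call $i$ active in $\xi$ if $\widetilde\omega_i(\xi)>0$. Let $\mathcal X=\Xi\times\{-1,1\}^n$, let $R_i\theta$ be $\theta$ with the sign of its $i$th component flipped, $S_i(\xi,\theta)=(\xi,R_i\theta)$, and $\pi(\xi,\theta)=2^{-n}\widetilde\pi(\xi)$. For $x=(\xi,\theta)$ with $i$ active in $\xi$ let $Q_i(x,\cdot)$ be the distribution with $$Q_i\big((\xi,\theta),(\xi',\theta)\big)=\frac{\widetilde Q(\xi,\xi')}{\widetilde Q(\xi,\mathcal N_i^{\theta_i}(\xi))}\quad\text{for }\xi'\in\mathcal N_i^{\theta_i}(\xi)$$ if $\mathcal N_i^{\theta_i}(\xi)\ne\emptyset$, and the point mass at $S_i(x)$ if $\mathcal N_i^{\theta_i}(\xi)=\emptyset$. Let $P_i$ be the kernel that from $x=(\xi,\theta)$ draws $x'=(\xi',\theta')\sim Q_i(x,\cdot)$, moves to $x'$ with probability $\min(1,r_i(x,x'))$, where $$r_i(x,x')=\frac{\widetilde\omega_i(\xi')\,\widetilde\pi(\xi')\,Q_i(S_i(x'),S_i(x))}{\widetilde\omega_i(\xi)\,\widetilde\pi(\xi)\,Q_i(x,x')},$$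 and moves to $S_i(x)$ otherwise. Let $\mathcal P((\xi,\theta),\cdot)=\sum_{i=1}^n\widetilde\omega_i(\xi)P_i((\xi,\theta),\cdot)$. Assume that for every $(\xi,\theta)\in\mathcal X$ and every $i$ active in $\xi$ there are $m\in\mathbb N$ and $\xi'\in\Xi$ with $P_i^m\big((\xi,\theta),(\xi',R_i\theta)\big)>0$. Then $\mathcal P$ is irreducible: for all $x,x'\in\mathcal X$ there is $m\in\mathbb N$ with $\mathcal P^m(x,x')>0$. Moreover, for every Markov chain $(x_k)_{k\in\mathbb N}$ with transition kernel $\mathcal P$, started at an arbitrary state $\tilde x_0\in\mathcal X$: (a) for every $x'\in\mathcal X$, almost surely $\displaystyle\lim_{N\to\infty}\frac1N\sum_{k=0}^{N-1}\mathbf 1_{\{x'\}}(x_k)=\pi(x')$; (b) for every $\varphi:\mathcal X\to\mathbb R$ with $\sum_{x\in\mathcal X}|\varphi(x)|\,\pi(x)<\infty$, almost surely $\displaystyle\lim_{N\to\infty}\frac1N\sum_{k=0}^{N-1}\varphi(x_k)=\sum_{x\in\mathcal X}\varphi(x)\pi(x)$. -/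

import Mathlib

open scoped ENNReal

noncomputable section

namespace LiftedFlow

/-! ### Markov chains on a discrete space -/

/-- The `m`-step transition kernel `K^m` of a Markov kernel `K` on a discrete space. -/
def kernelPow {S : Type*} (K : S → PMF S) : ℕ → S → PMF S
  | 0, x => PMF.pure x
  | m + 1, x => (kernelPow K m x).bind K

/-- Irreducibility: every state is reached from every state in finitely many steps
with positive probability. -/
def IsIrreducible {S : Type*} (K : S → PMF S) : Prop :=
  ∀ x x' : S, ∃ m : ℕ, 0 < kernelPow K m x x'

/-- `X` is (a realisation on the probability space `(Ω, μ)` of) the Markov chain with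
transition kernel `K` and deterministic initial state `x₀`. -/
structure IsMarkovChain {S Ω : Type*} [MeasurableSpace Ω] (μ : MeasureTheory.Measure Ω)
    (K : S → PMF S) (x₀ : S) (X : ℕ → Ω → S) : Prop where
  measurable : ∀ (k : ℕ) (x : S), MeasurableSet {ω | X k ω = x}
  initial : ∀ᵐ ω ∂μ, X 0 ω = x₀
  markov : ∀ (N : ℕ) (a : ℕ → S),
    μ {ω | ∀ k ≤ N + 1, X k ω = a k} = μ {ω | ∀ k ≤ N, X k ω = a k} * K (a N) (a (N + 1))

/-! ### Flows on the state graph of a proposal kernel -/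

/-- The reversed edge set `E⁻ = {(u, v) | (v, u) ∈ E⁺}`. -/
def reverseEdges {Ξ : Type*} (E : Set (Ξ × Ξ)) : Set (Ξ × Ξ) := {e | (e.2, e.1) ∈ E}

/-- The neighbourhood `{ξ' | (ξ, ξ') ∈ E}`. -/
def outNbhd {Ξ : Type*} (E : Set (Ξ × Ξ)) (ξ : Ξ) : Set Ξ := {ξ' | (ξ, ξ') ∈ E}

/-- A collection of `n` flows on the state graph of the proposal kernel `Q`: oriented subgraphs
`(V i, E i)` (here `E i` is the positive edge set `E_i⁺`) with nonempty edge sets and without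
isolated vertices, whose symmetric completions cover the state graph, and such that the weights
`ω_i(ξ) = Q(ξ, N_i⁺(ξ)) + Q(ξ, N_i⁻(ξ))` form a point of the standard simplex at each state. -/
structure Flows {Ξ : Type*} (Q : Ξ → PMF Ξ) (n : ℕ) where
  V : Fin n → Set Ξ
  E : Fin n → Set (Ξ × Ξ)
  edge_mem : ∀ i, ∀ e ∈ E i, e.1 ∈ V i ∧ e.2 ∈ V i
  edge_nonempty : ∀ i, (E i).Nonempty
  no_isolated : ∀ i, ∀ ξ ∈ V i, ∃ ξ', (ξ, ξ') ∈ E i ∪ reverseEdges (E i)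
  oriented : ∀ i, Disjoint (E i) (reverseEdges (E i))
  cover_vertices : ⋃ i, V i = Set.univ
  cover_edges : ⋃ i, (E i ∪ reverseEdges (E i)) = {e : Ξ × Ξ | 0 < Q e.1 e.2}
  weight_sum : ∀ ξ, ∑ i, ((Q ξ).toOuterMeasure (outNbhd (E i) ξ)
    + (Q ξ).toOuterMeasure (outNbhd (reverseEdges (E i)) ξ)) = 1

/-- The extended state space `Ξ × {-1, 1}ⁿ`. -/
abbrev ExtState (Ξ : Type*) (n : ℕ) : Type _ := Ξ × (Fin n → ℤˣ)

/-- `R_i` flips the sign of the `i`-th momentum component. -/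
def flipMomentum {n : ℕ} (i : Fin n) (θ : Fin n → ℤˣ) : Fin n → ℤˣ := Function.update θ i (-θ i)

/-- The involution `S_i (ξ, θ) = (ξ, R_i θ)`. -/
def involution {Ξ : Type*} {n : ℕ} (i : Fin n) (x : ExtState Ξ n) : ExtState Ξ n :=
  (x.1, flipMomentum i x.2)

/-- The extended target `π(ξ, θ) = 2⁻ⁿ π̃(ξ)`. -/
def extTarget {Ξ : Type*} {n : ℕ} (p : PMF Ξ) (x : ExtState Ξ n) : ℝ :=
  (1 / 2 ^ n) * (p x.1).toReal

/-- The Bernoulli distribution with success probability `min 1 r`; it is the law of the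
indicator of `u < r` for `u` uniform on `[0, 1]`. -/
def coin (r : ℝ≥0∞) : PMF Bool :=
  PMF.ofFintype (fun b => cond b (min 1 r) (1 - min 1 r)) (by simp)

namespace Flows

variable {Ξ : Type*} {Q : Ξ → PMF Ξ} {n : ℕ} (F : Flows Q n)

/-- The neighbourhood `N_i^s(ξ)` in direction `s ∈ {-1, 1}`. -/
def nbhd (i : Fin n) (s : ℤˣ) (ξ : Ξ) : Set Ξ :=
  if s = 1 then outNbhd (F.E i) ξ else outNbhd (reverseEdges (F.E i)) ξ

/-- The generic weights `ω_i(ξ) = Q(ξ, N_i⁺(ξ)) + Q(ξ, N_i⁻(ξ))`. -/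
def weight (ξ : Ξ) (i : Fin n) : ℝ≥0∞ :=
  (Q ξ).toOuterMeasure (F.nbhd i 1 ξ) + (Q ξ).toOuterMeasure (F.nbhd i (-1) ξ)

theorem sum_weight (ξ : Ξ) : ∑ i, F.weight ξ i = 1 := by
  have h : (-1 : ℤˣ) ≠ 1 := by decide
  simpa [weight, nbhd, h] using F.weight_sum ξ

theorem exists_mem_support {i : Fin n} {s : ℤˣ} {ξ : Ξ} (h : (F.nbhd i s ξ).Nonempty) :
    ∃ ξ' ∈ F.nbhd i s ξ, ξ' ∈ (Q ξ).support := by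
  obtain ⟨ξ', hξ'⟩ := h
  refine ⟨ξ', hξ', ?_⟩
  have h1 : (ξ, ξ') ∈ F.E i ∪ reverseEdges (F.E i) := by
    unfold nbhd at hξ'
    split_ifs at hξ'
    · exact Or.inl hξ'
    · exact Or.inr hξ'
  have h2 : (ξ, ξ') ∈ {e : Ξ × Ξ | 0 < Q e.1 e.2} := by
    rw [← F.cover_edges]
    exact Set.mem_iUnion.2 ⟨i, h1⟩
  exact (PMF.mem_support_iff _ _).2 (ne_of_gt h2)

/-- The index `i` is active in `ξ`. -/
def Active (ξ : Ξ) (i : Fin n) : Prop := 0 < F.weight ξ i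

open Classical in
/-- The proposal kernel `Q_i`: from `(ξ, θ)` it draws `ξ'` from `Q(ξ, ·)` conditioned on
`N_i^{θ_i}(ξ)` and keeps `θ`; if this neighbourhood is empty, it proposes `(ξ, R_i θ)`.
(Only its values at states in which `i` is active matter.) -/
def proposal (i : Fin n) (x : ExtState Ξ n) : PMF (ExtState Ξ n) :=
  if h : (F.nbhd i (x.2 i) x.1).Nonempty then
    ((Q x.1).filter (F.nbhd i (x.2 i) x.1) (F.exists_mem_support h)).map (fun ξ' => (ξ', x.2))
  else PMF.pure (involution i x)

/-- The Metropolis-Hastings ratio `r_i(x, x')`. -/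
def ratio (p : PMF Ξ) (i : Fin n) (x x' : ExtState Ξ n) : ℝ≥0∞ :=
  (F.weight x'.1 i * p x'.1 * F.proposal i (involution i x') (involution i x))
    / (F.weight x.1 i * p x.1 * F.proposal i x x')

/-- The kernel `P_i`: propose `x'` from `Q_i(x, ·)`, accept it with probability
`min(1, r_i(x, x'))`, and move to `S_i(x)` otherwise. -/
def stepKernel (p : PMF Ξ) (i : Fin n) (x : ExtState Ξ n) : PMF (ExtState Ξ n) :=
  (F.proposal i x).bind fun x' =>
    (coin (F.ratio p i x x')).map fun b => if b then x' else involution i x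

/-- The transition kernel `∑ i, ω_i(ξ) P_i((ξ, θ), ·)` of the lifted chain: draw `i` from
`ω(ξ)`, then move according to `P_i`. -/
def chainKernel (p : PMF Ξ) (x : ExtState Ξ n) : PMF (ExtState Ξ n) :=
  (PMF.ofFintype (F.weight x.1) (F.sum_weight x.1)).bind fun i => F.stepKernel p i x

/-- Every active momentum component can eventually be flipped by its own kernel `P_i`. -/
def Flippable (p : PMF Ξ) : Prop :=
  ∀ (ξ : Ξ) (θ : Fin n → ℤˣ) (i : Fin n), F.Active ξ i →
    ∃ (m : ℕ) (ξ' : Ξ), 0 < kernelPow (F.stepKernel p i) m (ξ, θ) (ξ', flipMomentum i θ)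

end Flows

/-- The assumptions on target and proposal: positivity, symmetric support, irreducibility. -/
structure Admissible {Ξ : Type*} (Q : Ξ → PMF Ξ) (p : PMF Ξ) : Prop where
  pos : ∀ ξ, 0 < p ξ
  symm : ∀ ξ ξ', Q ξ ξ' ≠ 0 ↔ Q ξ' ξ ≠ 0
  irreducible : IsIrreducible Q

end LiftedFlow

end

/-! Irreducibility rests on skew detailed balance: `ω_i π(x) P_i(x, y) = ω_i π(y) P_i(S_i y, S_i
x)`. Hence a `P_i`-path along which `θ` is constant can be retraced after flipping its `i`th sign.
By assumption some `P_i`-path from `x` changes the momentum. The first such change is an application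
of `S_i`, and retracing from there ends at `S_i x`, so active components can be flipped in place
(`reaches_involution`). An edge of `Q` is then crossed with the sign that its flow demands, and a
component inactive at `ξ` is flipped at some other position where it is active.

For the limits, summing skew detailed balance shows that `π` is invariant. For an irreducible kernel
with positive invariant law, bounded harmonic functions are constant, so the stationary path law is
ergodic under the shift and Birkhoff's theorem applies. As `π(x₀) > 0`, the law of the chain started
at `x₀` is absolutely continuous with respect to the stationary one and inherits its almost sure
limits. -/

open MeasureTheory Filter Topology

namespace LiftedFlow

/-! ### The pointwise ergodic theorem -/

section Birkhoff

variable {α : Type*}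

/-- The running maximum `max_{k ≤ n} S_k f` of the Birkhoff sums of `f`, defined recursively. -/
def birkhoffMax (T : α → α) (f : α → ℝ) : ℕ → α → ℝ
  | 0, _ => 0
  | n + 1, x => max 0 (f x + birkhoffMax T f n (T x))

theorem birkhoffMax_nonneg (T : α → α) (f : α → ℝ) (n : ℕ) (x : α) :
    0 ≤ birkhoffMax T f n x := by
  cases n with
  | zero => exact le_rfl
  | succ n => exact le_max_left _ _

theorem birkhoffMax_le_succ (T : α → α) (f : α → ℝ) (n : ℕ) (x : α) :
    birkhoffMax T f n x ≤ birkhoffMax T f (n + 1) x := by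
  induction n generalizing x with
  | zero => exact le_max_left _ _
  | succ n ih => exact max_le_max le_rfl (by simpa using ih (T x))

theorem birkhoffMax_mono (T : α → α) (f : α → ℝ) (x : α) :
    Monotone fun n => birkhoffMax T f n x :=
  monotone_nat_of_le_succ fun n => birkhoffMax_le_succ T f n x

theorem birkhoffSum_le_birkhoffMax (T : α → α) (f : α → ℝ) (n : ℕ) (x : α) :
    birkhoffSum T f n x ≤ birkhoffMax T f n x := by
  induction n generalizing x with
  | zero => simp [birkhoffMax]
  | succ n ih =>
    rw [birkhoffSum_succ']
    exact le_trans (by simpa using ih (T x)) (le_max_right _ _)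

/-- The set on which the running maxima of the Birkhoff sums are unbounded. -/
def birkhoffDivergence (T : α → α) (f : α → ℝ) : Set α :=
  {x | ∀ C : ℕ, ∃ n, (C : ℝ) < birkhoffMax T f n x}

/-- The recursion `M_{n+1}(x) = max 0 (f x + M_n(T x))` bounds the gap between the maxima at `x` and
at `T x` independently of `n`, so both are unbounded or neither is. -/
theorem preimage_birkhoffDivergence (T : α → α) (f : α → ℝ) :
    T ⁻¹' birkhoffDivergence T f = birkhoffDivergence T f := by
  ext x
  simp only [birkhoffDivergence, Set.mem_preimage, Set.mem_ofPred_eq]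
  constructor
  · intro h C
    obtain ⟨D, hD⟩ := exists_nat_gt ((C : ℝ) - f x)
    obtain ⟨n, hn⟩ := h D
    refine ⟨n + 1, lt_of_lt_of_le ?_ (le_max_right _ _)⟩
    linarith
  · intro h C
    obtain ⟨D, hD⟩ := exists_nat_gt (max 0 ((C : ℝ) + f x))
    obtain ⟨n, hn⟩ := h D
    have h0 : (0 : ℝ) < birkhoffMax T f n x :=
      lt_of_le_of_lt (le_max_left _ _) (hD.trans hn)
    cases n with
    | zero => exact absurd h0 (lt_irrefl _)
    | succ n =>
      refine ⟨n, ?_⟩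
      have h1 : (C : ℝ) + f x < birkhoffMax T f (n + 1) x :=
        lt_of_le_of_lt (le_max_right _ _) (hD.trans hn)
      simp only [birkhoffMax] at h0 h1
      rcases lt_max_iff.1 h0 with h2 | h2
      · exact absurd h2 (lt_irrefl _)
      · rw [max_eq_right h2.le] at h1
        linarith

variable [MeasurableSpace α] {T : α → α} {f : α → ℝ} {ν : Measure α}

theorem measurable_birkhoffMax (hT : Measurable T) (hf : Measurable f) (n : ℕ) :
    Measurable (birkhoffMax T f n) := by
  induction n with
  | zero => exact measurable_const
  | succ n ih => exact measurable_const.max (hf.add (ih.comp hT))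

theorem integrable_birkhoffMax (hT : MeasurePreserving T ν ν) (hf : Integrable f ν) (n : ℕ) :
    Integrable (birkhoffMax T f n) ν := by
  induction n with
  | zero => exact integrable_zero _ _ _
  | succ n ih =>
    exact (integrable_zero _ _ _).sup (hf.add (hT.integrable_comp_of_integrable ih))

theorem measurableSet_birkhoffDivergence (hT : Measurable T) (hf : Measurable f) :
    MeasurableSet (birkhoffDivergence T f) := by
  have : birkhoffDivergence T f = ⋂ C : ℕ, ⋃ n, {x | (C : ℝ) < birkhoffMax T f n x} := by
    ext x; simp [birkhoffDivergence]
  rw [this]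
  exact .iInter fun C => .iUnion fun n =>
    measurableSet_lt measurable_const (measurable_birkhoffMax hT hf n)

/-- The maximal ergodic inequality on the set of divergence. -/
theorem setIntegral_birkhoffDivergence_nonneg (hT : MeasurePreserving T ν ν)
    (hfm : Measurable f) (hf : Integrable f ν) :
    0 ≤ ∫ x in birkhoffDivergence T f, f x ∂ν := by
  set A := birkhoffDivergence T f with hA
  have hAm : MeasurableSet A := measurableSet_birkhoffDivergence hT.measurable hfm
  -- The integrand is `max (-M_n(T x)) (f x)`: dominated by `|f|`, and equal to `f x` once `M_n(T x)
  -- ≥ -f x`, which happens eventually on `A`.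
  have hlim : Tendsto (fun n => ∫ x in A, (birkhoffMax T f (n + 1) x - birkhoffMax T f n (T x)) ∂ν)
      atTop (𝓝 (∫ x in A, f x ∂ν)) := by
    refine tendsto_integral_of_dominated_convergence (fun x => |f x|) (fun n => ?_)
      hf.abs.integrableOn (fun n => ?_) ?_
    · exact ((measurable_birkhoffMax hT.measurable hfm _).sub
        ((measurable_birkhoffMax hT.measurable hfm _).comp hT.measurable)).aestronglyMeasurable
    · refine Eventually.of_forall fun x => ?_
      have h0 := birkhoffMax_nonneg T f n (T x)
      simp only [birkhoffMax, Real.norm_eq_abs]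
      rcases le_total 0 (f x + birkhoffMax T f n (T x)) with h | h
      · rw [max_eq_right h]; simp
      · rw [max_eq_left h, abs_le]
        have := neg_abs_le (f x)
        have := abs_nonneg (f x)
        constructor <;> [skip; linarith]
        rw [abs_of_nonpos (by linarith)]
        linarith
    · refine (ae_restrict_iff' hAm).2 (Eventually.of_forall fun x hx => ?_)
      have hx' : T x ∈ A := by
        rw [← Set.mem_preimage, hA, preimage_birkhoffDivergence]; exact hx
      obtain ⟨C, hC⟩ := exists_nat_gt (-f x)
      obtain ⟨n, hn⟩ := hx' C
      refine tendsto_const_nhds.congr' ?_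
      filter_upwards [eventually_ge_atTop n] with m hm
      have := birkhoffMax_mono T f (T x) hm
      simp only [birkhoffMax] at this ⊢
      rw [max_eq_right (by linarith)]
      ring
  -- Since `A` and `ν` are invariant, `M_n ∘ T` and `M_n` have the same integral over `A`, and `M_n
  -- ≤ M_{n+1}` makes each approximant nonnegative.
  refine ge_of_tendsto' hlim fun n => ?_
  have hi := integrable_birkhoffMax hT hf
  have hcomp : ∫ x in A, birkhoffMax T f n (T x) ∂ν = ∫ x in A, birkhoffMax T f n x ∂ν := by
    have h := hT.restrict_preimage hAm
    rw [hA, preimage_birkhoffDivergence] at h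
    conv_rhs => rw [hA, ← h.map_eq]
    rw [integral_map h.measurable.aemeasurable
      (measurable_birkhoffMax hT.measurable hfm n).aestronglyMeasurable]
  have hiT : Integrable (fun x => birkhoffMax T f n (T x)) ν :=
    hT.integrable_comp_of_integrable (hi n)
  rw [integral_sub (hi _).integrableOn hiT.integrableOn, hcomp, sub_nonneg]
  exact setIntegral_mono (hi _).integrableOn (hi _).integrableOn
    fun x => birkhoffMax_le_succ T f n x

/-- By ergodicity the divergence set is null or conull; conull would contradict the maximal
inequality, as `∫ f < 0`. -/
theorem ae_exists_birkhoffSum_le (hT : Ergodic T ν)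
    (hfm : Measurable f) (hf : Integrable f ν) (hneg : ∫ x, f x ∂ν < 0) :
    ∀ᵐ x ∂ν, ∃ C : ℕ, ∀ n, birkhoffSum T f n x ≤ C := by
  have hAm : MeasurableSet (birkhoffDivergence T f) :=
    measurableSet_birkhoffDivergence hT.measurable hfm
  have hnonneg := setIntegral_birkhoffDivergence_nonneg hT.toMeasurePreserving hfm hf
  have hnull : birkhoffDivergence T f =ᵐ[ν] (∅ : Set α) := by
    rcases hT.toPreErgodic.ae_empty_or_univ hAm (preimage_birkhoffDivergence T f) with h | h
    · exact h
    · rw [setIntegral_congr_set h, setIntegral_univ] at hnonneg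
      exact absurd hnonneg (not_le.2 hneg)
  filter_upwards [measure_eq_zero_iff_ae_notMem.1 (ae_eq_empty.1 hnull)] with x hx
  simp only [birkhoffDivergence, Set.mem_ofPred_eq, not_forall, not_exists, not_lt] at hx
  obtain ⟨C, hC⟩ := hx
  exact ⟨C, fun n => (birkhoffSum_le_birkhoffMax T f n x).trans (hC n)⟩

/-- Subtracting slightly more than the mean makes the integral negative, hence the Birkhoff sums
bounded above. The margins `1 / (m + 1)` are countably many, so one null set serves every `ε`. -/
theorem ae_eventually_birkhoffAverage_le [IsProbabilityMeasure ν] (hT : Ergodic T ν)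
    (hfm : Measurable f) (hf : Integrable f ν) :
    ∀ᵐ x ∂ν, ∀ ε > 0, ∀ᶠ n : ℕ in atTop,
      (1 / (n : ℝ)) * birkhoffSum T f n x < ∫ y, f y ∂ν + ε := by
  have key : ∀ m : ℕ, ∀ᵐ x ∂ν, ∃ C : ℕ, ∀ n,
      birkhoffSum T (fun y => f y - (∫ z, f z ∂ν + 1 / ((m : ℝ) + 1))) n x ≤ C := by
    intro m
    refine ae_exists_birkhoffSum_le hT (hfm.sub measurable_const)
      (hf.sub (integrable_const _)) ?_
    rw [integral_sub hf (integrable_const _)]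
    have : (0 : ℝ) < 1 / ((m : ℝ) + 1) := by positivity
    simp only [integral_const, probReal_univ, smul_eq_mul, one_mul]
    linarith
  filter_upwards [ae_all_iff.2 key] with x hx ε hε
  -- Half of `ε` covers the margin `1 / (m + 1)`, the other half covers `C / n`.
  obtain ⟨m, hm⟩ := exists_nat_one_div_lt (half_pos hε)
  obtain ⟨C, hC⟩ := hx m
  obtain ⟨N, hN⟩ := exists_nat_gt (C / (ε / 2))
  filter_upwards [eventually_ge_atTop N, eventually_gt_atTop 0] with n hn hn0
  have hn0' : (0 : ℝ) < n := by exact_mod_cast hn0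
  have h1 := hC n
  have h2 : birkhoffSum T (fun y => f y - (∫ z, f z ∂ν + 1 / ((m : ℝ) + 1))) n x
      = birkhoffSum T f n x - n * (∫ z, f z ∂ν + 1 / ((m : ℝ) + 1)) := by
    simp [birkhoffSum, Finset.sum_sub_distrib, mul_add]
  rw [h2] at h1
  have h3 : (C : ℝ) < n * (ε / 2) := by
    rw [div_lt_iff₀ (half_pos hε)] at hN
    have : (N : ℝ) ≤ n := by exact_mod_cast hn
    nlinarith
  rw [one_div, inv_mul_lt_iff₀ hn0']
  nlinarith

/-- **Pointwise ergodic theorem** for an ergodic transformation of a probability space. -/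
theorem ae_tendsto_birkhoffAverage [IsProbabilityMeasure ν] (hT : Ergodic T ν)
    (hfm : Measurable f) (hf : Integrable f ν) :
    ∀ᵐ x ∂ν, Tendsto (fun n : ℕ => (1 / (n : ℝ)) * birkhoffSum T f n x)
      atTop (𝓝 (∫ y, f y ∂ν)) := by
  filter_upwards [ae_eventually_birkhoffAverage_le hT hfm hf,
    ae_eventually_birkhoffAverage_le hT hfm.neg hf.neg] with x h1 h2
  rw [Metric.tendsto_nhds]
  intro ε hε
  filter_upwards [h1 ε hε, h2 ε hε] with n h3 h4
  simp only [birkhoffSum, Pi.neg_apply, Finset.sum_neg_distrib, integral_neg, mul_neg] at h3 h4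
  rw [Real.dist_eq, abs_lt]
  simp only [birkhoffSum]
  constructor <;> linarith

end Birkhoff

/-! ### Laws of Markov chains on path space -/

section PathSpace

variable {S : Type*}

/-- The set of paths that agree with `a` up to time `N`. -/
def pathCylinder (N : ℕ) (a : ℕ → S) : Set (ℕ → S) := {x | ∀ k ≤ N, x k = a k}

/-- The time shift of paths. -/
def pathShift (x : ℕ → S) : ℕ → S := fun k => x (k + 1)

/-- The path that starts in `s` and continues as `a`. -/
def pathCons (s : S) (a : ℕ → S) : ℕ → S
  | 0 => s
  | k + 1 => a k

/-- The set of paths that start in `s`. -/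
def startsAt (s : S) : Set (ℕ → S) := {x | x 0 = s}

theorem startsAt_inter_preimage_pathShift (s : S) (N : ℕ) (a : ℕ → S) :
    startsAt s ∩ pathShift ⁻¹' pathCylinder N a = pathCylinder (N + 1) (pathCons s a) := by
  ext x
  constructor
  · rintro ⟨h0, h⟩ (_ | k) hk
    · exact h0
    · exact h k (by omega)
  · intro h
    exact ⟨h 0 (by omega), fun k hk => h (k + 1) (by omega)⟩

theorem pathCylinder_succ_eq (N : ℕ) (a : ℕ → S) :
    pathCylinder (N + 1) a = startsAt (a 0) ∩ pathShift ⁻¹' pathCylinder N (pathShift a) := by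
  rw [startsAt_inter_preimage_pathShift]
  congr 1
  funext k
  cases k <;> rfl

theorem pathCylinder_subset_startsAt (N : ℕ) (a : ℕ → S) :
    pathCylinder N a ⊆ startsAt (a 0) := fun _ hx => hx 0 (Nat.zero_le _)

theorem pathCylinder_zero (a : ℕ → S) : pathCylinder 0 a = startsAt (a 0) := by
  ext x
  constructor
  · exact fun hx => hx 0 le_rfl
  · intro hx k hk
    obtain rfl : k = 0 := by omega
    exact hx

variable [MeasurableSpace S]

theorem measurable_pathShift : Measurable (pathShift : (ℕ → S) → ℕ → S) :=
  measurable_pi_lambda _ fun _ => measurable_pi_apply _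

/-- The law on path space of the Markov chain with kernel `K` and initial weights `p`. -/
structure IsPathLaw (ν : Measure (ℕ → S)) (K : S → PMF S) (p : S → ℝ≥0∞) : Prop where
  initial : ∀ s, ν (startsAt s) = p s
  step : ∀ N a, ν (pathCylinder (N + 1) a) = ν (pathCylinder N a) * K (a N) (a (N + 1))

theorem IsPathLaw.pathCylinder_eq {ν : Measure (ℕ → S)} {K : S → PMF S} {p : S → ℝ≥0∞}
    (h : IsPathLaw ν K p) (N : ℕ) (a : ℕ → S) :
    ν (pathCylinder N a) = p (a 0) * ∏ k ∈ Finset.range N, K (a k) (a (k + 1)) := by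
  induction N with
  | zero => rw [pathCylinder_zero, h.initial]; simp
  | succ N ih => rw [h.step, ih, Finset.prod_range_succ, mul_assoc]

variable [DiscreteMeasurableSpace S]

theorem measurableSet_startsAt (s : S) : MeasurableSet (startsAt s) :=
  measurable_pi_apply (X := fun _ : ℕ => S) 0 (measurableSet_singleton s)

theorem measurableSet_pathCylinder (N : ℕ) (a : ℕ → S) : MeasurableSet (pathCylinder N a) := by
  induction N generalizing a with
  | zero => rw [pathCylinder_zero]; exact measurableSet_startsAt _
  | succ N ih =>
    rw [pathCylinder_succ_eq]
    exact (measurableSet_startsAt _).inter (measurable_pathShift (ih _))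

variable [Countable S]

theorem measure_eq_tsum_startsAt (ν : Measure (ℕ → S)) {B : Set (ℕ → S)} (hB : MeasurableSet B) :
    ν B = ∑' s, ν (startsAt s ∩ B) := by
  rw [← measure_iUnion]
  · congr 1
    ext x
    simp [startsAt]
  · intro s t hst
    refine Set.disjoint_left.2 ?_
    rintro x ⟨hx, -⟩ ⟨hx', -⟩
    exact hst (hx.symm.trans hx')
  · exact fun s => (measurableSet_startsAt s).inter hB

/-- A finite measure on path space is determined by its values on cylinders. -/
theorem measure_ext_of_pathCylinder {μ ν : Measure (ℕ → S)} [IsFiniteMeasure μ]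
    (h : ∀ N a, μ (pathCylinder N a) = ν (pathCylinder N a)) : μ = ν := by
  have hle : ∀ N, μ.map (Preorder.frestrictLe (π := fun _ : ℕ => S) N)
      = ν.map (Preorder.frestrictLe N) := by
    intro N
    refine Measure.ext_of_singleton fun b => ?_
    rw [Measure.map_apply (by fun_prop) (measurableSet_singleton _),
      Measure.map_apply (by fun_prop) (measurableSet_singleton _)]
    -- The value after time `N` is irrelevant; `b 0` is a state at hand even if `S` has no chosen
    -- default.
    have : Preorder.frestrictLe (π := fun _ : ℕ => S) N ⁻¹' {b}
        = pathCylinder N fun k => if hk : k ≤ N then b ⟨k, by simpa using hk⟩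
          else b ⟨0, by simp⟩ := by
      ext x
      simp only [Set.mem_preimage, Set.mem_singleton_iff, pathCylinder]
      constructor
      · rintro rfl k hk
        simp [hk]
      · intro hx
        ext ⟨k, hk⟩
        have hk' : k ≤ N := by simpa using hk
        have := hx k hk'
        simpa [hk'] using this
    rw [this, h]
  have hI : ∀ I : Finset ℕ, μ.map (I.restrict (π := fun _ : ℕ => S)) = ν.map I.restrict := by
    intro I
    have hsub : I ⊆ Finset.Iic (I.sup id) := fun i hi =>
      Finset.mem_Iic.2 (Finset.le_sup (f := id) hi)
    have hcomp : I.restrict (π := fun _ : ℕ => S)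
        = Finset.restrict₂ (π := fun _ : ℕ => S) hsub ∘ Preorder.frestrictLe (I.sup id) := rfl
    rw [hcomp, ← Measure.map_map (by fun_prop) (by fun_prop),
      ← Measure.map_map (by fun_prop) (by fun_prop), hle]
  exact IsProjectiveLimit.unique (P := fun I => μ.map (I.restrict (π := fun _ : ℕ => S)))
    (fun I => rfl) (fun I => (hI I).symm)

open ProbabilityTheory in
/-- Existence of Markov chains: the Ionescu-Tulcea theorem for a time-homogeneous kernel. -/
theorem exists_isPathLaw (K : S → PMF S) (p : PMF S) :
    ∃ ν : Measure (ℕ → S), IsProbabilityMeasure ν ∧ IsPathLaw ν K p := by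
  -- The kernel on histories looks only at the last state.
  let κ : (n : ℕ) → Kernel (Π _ : Finset.Iic n, S) S := fun n =>
    Kernel.ofFunOfCountable fun x => (K (x ⟨n, by simp⟩)).toMeasure
  have hκ : ∀ n, IsMarkovKernel (κ n) := fun n =>
    ⟨fun x => inferInstanceAs (IsProbabilityMeasure (K (x ⟨n, by simp⟩)).toMeasure)⟩
  let ν : Measure (ℕ → S) := Kernel.trajMeasure (X := fun _ => S) p.toMeasure κ
  have hprob : IsProbabilityMeasure ν :=
    inferInstanceAs (IsProbabilityMeasure (Kernel.trajMeasure (X := fun _ => S) p.toMeasure κ))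
  refine ⟨ν, hprob, ?_, ?_⟩
  · intro s
    have h0 : ν.map (Preorder.frestrictLe (π := fun _ : ℕ => S) 0)
        = p.toMeasure.map (MeasurableEquiv.piUnique fun _ : Finset.Iic 0 => S).symm := by
      change Measure.map _ (Measure.bind _ _) = _
      rw [Measure.map_comp _ _ (by fun_prop), Kernel.traj_map_frestrictLe, Kernel.partialTraj_self,
        Measure.id_comp]
    have h1 : ν (startsAt s) = (ν.map (Preorder.frestrictLe (π := fun _ : ℕ => S) 0))
        {b | b ⟨0, by simp⟩ = s} := by
      rw [Measure.map_apply (by fun_prop) (Set.to_countable _).measurableSet]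
      rfl
    rw [h1, h0, Measure.map_apply (by fun_prop) (Set.to_countable _).measurableSet]
    have : (MeasurableEquiv.piUnique fun _ : Finset.Iic 0 => S).symm ⁻¹' {b | b ⟨0, by simp⟩ = s}
        = {s} := by
      ext t
      rfl
    rw [this, PMF.toMeasure_apply_singleton _ _ (measurableSet_singleton _)]
  · intro N a
    have h := congrArg (fun m : Measure _ => m
      ({fun k : Finset.Iic N => a k} ×ˢ {a (N + 1)}))
      (Kernel.map_frestrictLe_trajMeasure_compProd_eq_map_trajMeasure (X := fun _ => S)
        (μ₀ := p.toMeasure) (κ := κ) (a := N))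
    have hm : MeasurableSet ({fun k : Finset.Iic N => a k} ×ˢ {a (N + 1)}
      : Set ((Finset.Iic N → S) × S)) := (Set.to_countable _).measurableSet
    beta_reduce at h
    rw [Measure.compProd_apply_prod (measurableSet_singleton _) (measurableSet_singleton _),
      Measure.map_apply (by fun_prop) hm, Measure.restrict_singleton, lintegral_smul_measure,
      lintegral_dirac, Measure.map_apply (by fun_prop) (measurableSet_singleton _)] at h
    have e1 : (fun x : ℕ → S => (Preorder.frestrictLe (π := fun _ : ℕ => S) N x, x (N + 1))) ⁻¹'
        ({fun k : Finset.Iic N => a k} ×ˢ {a (N + 1)}) = pathCylinder (N + 1) a := by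
      ext x
      simp only [Set.mem_preimage, Set.mem_prod, Set.mem_singleton_iff, pathCylinder,
        funext_iff, Subtype.forall, Finset.mem_Iic]
      constructor
      · rintro ⟨h1, h2⟩ k hk
        rcases Nat.lt_or_ge N k with h3 | h3
        · obtain rfl : k = N + 1 := by omega
          exact h2
        · exact h1 k h3
      · intro hx
        exact ⟨fun k hk => hx k (by omega), hx _ le_rfl⟩
    have e2 : Preorder.frestrictLe (π := fun _ : ℕ => S) N ⁻¹' {fun k : Finset.Iic N => a k}
        = pathCylinder N a := by
      ext x
      simp only [Set.mem_preimage, Set.mem_singleton_iff, pathCylinder,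
        funext_iff, Subtype.forall, Finset.mem_Iic]
      rfl
    rw [e1, e2] at h
    change ν (pathCylinder N a) • (K (a N)).toMeasure {a (N + 1)} = ν (pathCylinder (N + 1) a) at h
    rw [← h, PMF.toMeasure_apply_singleton _ _ (measurableSet_singleton _), smul_eq_mul]

/-- Invariant initial laws make the shift measure preserving. -/
theorem IsPathLaw.measurePreserving {ν : Measure (ℕ → S)} [IsFiniteMeasure ν] {K : S → PMF S}
    {p : PMF S} (h : IsPathLaw ν K p) (hp : p.bind K = p) :
    MeasurePreserving pathShift ν ν := by
  refine ⟨measurable_pathShift, measure_ext_of_pathCylinder fun N a => ?_⟩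
  have hm := measurable_pathShift (measurableSet_pathCylinder N a)
  rw [Measure.map_apply measurable_pathShift (measurableSet_pathCylinder N a),
    measure_eq_tsum_startsAt ν hm]
  simp_rw [startsAt_inter_preimage_pathShift, h.pathCylinder_eq, Finset.prod_range_succ',
    pathCons]
  -- The sum runs over the state `s` dropped by the shift; invariance supplies `∑ p s * K s (a 0) =
  -- p (a 0)`.
  conv_rhs => rw [← hp, PMF.bind_apply, ← ENNReal.tsum_mul_right]
  refine tsum_congr fun s => ?_
  ring

/-- The Markov property at time one. -/
theorem IsPathLaw.markov {ν : Measure (ℕ → S)} [IsFiniteMeasure ν] {K : S → PMF S}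
    {p : PMF S} (h : IsPathLaw ν K p) (s t : S) {B : Set (ℕ → S)} (hB : MeasurableSet B) :
    p t * ν (startsAt s ∩ pathShift ⁻¹' (startsAt t ∩ B)) = p s * K s t * ν (startsAt t ∩ B) := by
  -- An identity between finite measures need only be checked on cylinders, where the product
  -- formula gives it.
  have key : p t • ((ν.restrict (startsAt s)).map pathShift).restrict (startsAt t)
      = (p s * K s t) • ν.restrict (startsAt t) := by
    have hfin : IsFiniteMeasure
        (p t • ((ν.restrict (startsAt s)).map pathShift).restrict (startsAt t)) :=
      Measure.smul_finite _ (p.apply_ne_top t)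
    refine measure_ext_of_pathCylinder fun N a => ?_
    have hc := measurableSet_pathCylinder N a
    simp only [Measure.smul_apply, smul_eq_mul]
    rw [Measure.restrict_apply hc, Measure.restrict_apply hc,
      Measure.map_apply measurable_pathShift (hc.inter (measurableSet_startsAt t)),
      Measure.restrict_apply (measurable_pathShift (hc.inter (measurableSet_startsAt t)))]
    by_cases hat : a 0 = t
    · subst hat
      rw [Set.inter_eq_left.2 (pathCylinder_subset_startsAt N a), Set.inter_comm,
        startsAt_inter_preimage_pathShift, h.pathCylinder_eq, h.pathCylinder_eq,
        Finset.prod_range_succ']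
      simp only [pathCons]
      ring
    · have : pathCylinder N a ∩ startsAt t = ∅ := by
        refine Set.eq_empty_of_forall_notMem fun x hx => hat ?_
        exact (pathCylinder_subset_startsAt N a hx.1).symm.trans hx.2
      simp [this]
  have h2 := congrArg (fun m : Measure _ => m B) key
  simp only [Measure.smul_apply, smul_eq_mul] at h2
  rwa [Measure.restrict_apply hB, Measure.restrict_apply hB,
    Measure.map_apply measurable_pathShift (hB.inter (measurableSet_startsAt t)),
    Measure.restrict_apply (measurable_pathShift (hB.inter (measurableSet_startsAt t))),
    Set.inter_comm, Set.inter_comm B] at h2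

end PathSpace

/-! ### Ergodicity of irreducible stationary chains -/

section Ergodicity

variable {S : Type*}

/-- The equality case that turns equal means into pointwise equality in `le_of_harmonic`. -/
theorem tsum_eq_tsum_imp {f g : S → ℝ≥0∞} (hle : ∀ s, f s ≤ g s) (hfin : ∑' s, g s ≠ ∞)
    (heq : ∑' s, f s = ∑' s, g s) (s : S) : f s = g s := by
  by_contra hne
  exact absurd heq (ENNReal.tsum_lt_tsum
    (ne_top_of_le_ne_top hfin (ENNReal.tsum_le_tsum hle)) hle (lt_of_le_of_ne (hle s) hne)).ne

theorem tsum_mul_const_pmf (q : PMF S) (c : ℝ≥0∞) : ∑' t, q t * c = c := by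
  rw [ENNReal.tsum_mul_right, q.tsum_coe, one_mul]

/-- A bounded harmonic function of a kernel with a positive invariant distribution does not
decrease along transitions. -/
theorem le_of_harmonic {K : S → PMF S} {p : PMF S} (hpos : ∀ s, 0 < p s) (hp : p.bind K = p)
    {h : S → ℝ≥0∞} (hle : ∀ s, h s ≤ 1) (hK : ∀ s, ∑' t, K s t * h t = h s)
    {s t : S} (hst : 0 < K s t) : h s ≤ h t := by
  set c := h s with hc
  have hctop : c ≠ ∞ := ne_top_of_le_ne_top ENNReal.one_ne_top (hle s)
  -- The truncation `g` is superharmonic, and invariance gives `K g` and `g` the same `p`-mean, so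
  -- `K g = g`. At `s` the function `g` attains its upper bound `c`, so it equals `c` at every
  -- successor of `s`.
  let g : S → ℝ≥0∞ := fun u => min (h u) c
  have hKg : ∀ u, ∑' v, K u v * g v ≤ g u := fun u =>
    le_min ((ENNReal.tsum_le_tsum fun v => mul_le_mul_right (min_le_left _ _) _).trans (hK u).le)
      ((ENNReal.tsum_le_tsum fun v => mul_le_mul_right (min_le_right _ _) _).trans
        (tsum_mul_const_pmf (K u) c).le)
  have hmean : ∑' u, p u * ∑' v, K u v * g v = ∑' u, p u * g u := by
    conv_rhs => rw [← hp]
    simp_rw [PMF.bind_apply, ← ENNReal.tsum_mul_right, ← ENNReal.tsum_mul_left]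
    rw [ENNReal.tsum_comm]
    simp_rw [mul_assoc]
  have hfin : ∑' u, p u * g u ≠ ∞ :=
    ne_top_of_le_ne_top hctop ((ENNReal.tsum_le_tsum fun v =>
      mul_le_mul_right (min_le_right _ _) _).trans (tsum_mul_const_pmf p c).le)
  have hgs := tsum_eq_tsum_imp (fun u => mul_le_mul_right (hKg u) (p u)) hfin hmean s
  rw [ENNReal.mul_right_inj (hpos s).ne' (p.apply_ne_top s)] at hgs
  have hgc : g s = c := min_self c
  have h1 := tsum_eq_tsum_imp (fun v => mul_le_mul_right (min_le_right (h v) c) (K s v))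
    (by rwa [tsum_mul_const_pmf]) (by rw [tsum_mul_const_pmf]; exact hgs.trans hgc) t
  rw [ENNReal.mul_right_inj hst.ne' ((K s).apply_ne_top t)] at h1
  exact min_eq_right_iff.1 h1

theorem reflTransGen_of_kernelPow_pos {K : S → PMF S} {m : ℕ} {x y : S}
    (h : 0 < kernelPow K m x y) : Relation.ReflTransGen (fun a b => 0 < K a b) x y := by
  induction m generalizing y with
  | zero =>
    have : y = x := by
      by_contra hne
      simp [kernelPow, PMF.pure_apply, hne] at h
    rw [this]
  | succ m ih =>
    have h' : y ∈ ((kernelPow K m x).bind K).support := (PMF.mem_support_iff _ _).2 h.ne'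
    obtain ⟨z, hz, hzy⟩ := (PMF.mem_support_bind_iff _ _ _).1 h'
    exact (ih (pos_iff_ne_zero.2 ((PMF.mem_support_iff _ _).1 hz))).tail
      (pos_iff_ne_zero.2 ((PMF.mem_support_iff _ _).1 hzy))

theorem exists_kernelPow_pos {K : S → PMF S} {x y : S}
    (h : Relation.ReflTransGen (fun a b => 0 < K a b) x y) : ∃ m, 0 < kernelPow K m x y := by
  induction h with
  | refl => exact ⟨0, by simp [kernelPow]⟩
  | @tail z y _ hzy ih =>
    obtain ⟨m, hm⟩ := ih
    refine ⟨m + 1, pos_iff_ne_zero.2 ((PMF.mem_support_iff _ _).1 ?_)⟩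
    exact (PMF.mem_support_bind_iff _ _ _).2 ⟨z, (PMF.mem_support_iff _ _).2 hm.ne',
      (PMF.mem_support_iff _ _).2 hzy.ne'⟩

/-- Bounded harmonic functions of an irreducible positive recurrent kernel are constant. -/
theorem eq_of_harmonic {K : S → PMF S} {p : PMF S} (hpos : ∀ s, 0 < p s) (hp : p.bind K = p)
    (hirr : IsIrreducible K) {h : S → ℝ≥0∞} (hle : ∀ s, h s ≤ 1)
    (hK : ∀ s, ∑' t, K s t * h t = h s) (s t : S) : h s = h t := by
  have hmono : ∀ u v, h u ≤ h v := by
    intro u v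
    obtain ⟨m, hm⟩ := hirr u v
    have hm' := reflTransGen_of_kernelPow_pos hm
    clear hm
    induction hm' with
    | refl => exact le_rfl
    | tail _ hvw ih => exact ih.trans (le_of_harmonic hpos hp hle hK hvw)
  exact le_antisymm (hmono s t) (hmono t s)

variable [MeasurableSpace S] [DiscreteMeasurableSpace S] [Countable S]

/-- The stationary law of an irreducible chain is ergodic under the shift. -/
theorem IsPathLaw.ergodic {ν : Measure (ℕ → S)} [IsProbabilityMeasure ν] {K : S → PMF S}
    {p : PMF S} (h : IsPathLaw ν K p) (hpos : ∀ s, 0 < p s) (hp : p.bind K = p)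
    (hirr : IsIrreducible K) : Ergodic pathShift ν := by
  refine ⟨h.measurePreserving hp, ⟨fun {A} hA hinv => ?_⟩⟩
  -- The conditional probability of `A` given the initial state. Shift invariance of `A` and the
  -- Markov property make it harmonic, hence constant.
  let q : S → ℝ≥0∞ := fun s => ν (startsAt s ∩ A) / p s
  have hq : ∀ s, p s * q s = ν (startsAt s ∩ A) := fun s =>
    ENNReal.mul_div_cancel (hpos s).ne' (p.apply_ne_top s)
  have hstep : ∀ s t {B : Set (ℕ → S)}, MeasurableSet B →
      ν (startsAt s ∩ pathShift ⁻¹' (startsAt t ∩ B))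
        = p s * K s t * (ν (startsAt t ∩ B) / p t) := by
    intro s t B hB
    rw [← ENNReal.mul_right_inj (hpos t).ne' (p.apply_ne_top t), h.markov s t hB,
      mul_left_comm, ENNReal.mul_div_cancel (hpos t).ne' (p.apply_ne_top t)]
  have hqle : ∀ s, q s ≤ 1 := fun s => by
    refine ENNReal.div_le_of_le_mul ?_
    rw [one_mul, ← h.initial]
    exact measure_mono Set.inter_subset_left
  have hharm : ∀ s, ∑' t, K s t * q t = q s := by
    intro s
    rw [← ENNReal.mul_right_inj (hpos s).ne' (p.apply_ne_top s), hq, ← ENNReal.tsum_mul_left]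
    have h1 : ν (startsAt s ∩ A) = ((ν.restrict (startsAt s)).map pathShift) A := by
      rw [Measure.map_apply measurable_pathShift hA, hinv, Measure.restrict_apply hA,
        Set.inter_comm]
    rw [h1, measure_eq_tsum_startsAt _ hA]
    refine tsum_congr fun t => ?_
    have hm := (measurableSet_startsAt t).inter hA
    rw [Measure.map_apply measurable_pathShift hm,
      Measure.restrict_apply (measurable_pathShift hm), Set.inter_comm, hstep s t hA, mul_assoc]
  obtain ⟨s₀, -⟩ := p.support_nonempty
  have hconst : ∀ s, q s = q s₀ := fun s => eq_of_harmonic hpos hp hirr hqle hharm s s₀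
  -- Thus `A` is independent of every cylinder, hence of itself, which forces `ν A` to be 0 or 1.
  have hcyl : ∀ N a, ν (pathCylinder N a ∩ A) = q s₀ * ν (pathCylinder N a) := by
    intro N
    induction N with
    | zero =>
      intro a
      rw [pathCylinder_zero, ← hq, hconst, h.initial, mul_comm]
    | succ N ih =>
      intro a
      have hcm := measurableSet_pathCylinder N (pathShift a)
      have hsub : startsAt (a 1) ∩ pathCylinder N (pathShift a) = pathCylinder N (pathShift a) :=
        Set.inter_eq_right.2 (pathCylinder_subset_startsAt N (pathShift a))
      have e1 := hstep (a 0) (a 1) (hcm.inter hA)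
      have e2 := hstep (a 0) (a 1) hcm
      rw [← Set.inter_assoc, hsub, ih, Set.preimage_inter, hinv, ← Set.inter_assoc,
        ← pathCylinder_succ_eq] at e1
      rw [hsub, ← pathCylinder_succ_eq] at e2
      rw [e1, e2, mul_div_assoc, mul_left_comm]
  have hq_top : q s₀ ≠ ∞ := ne_top_of_le_ne_top ENNReal.one_ne_top (hqle s₀)
  have hmeas : ν.restrict A = q s₀ • ν := by
    refine measure_ext_of_pathCylinder fun N a => ?_
    rw [Measure.restrict_apply (measurableSet_pathCylinder N a), hcyl]
    rfl
  have hA1 : ν A = q s₀ := by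
    have := congrArg (fun m : Measure _ => m Set.univ) hmeas
    simpa using this
  have hA2 : ν A = q s₀ * ν A := by
    have := congrArg (fun m : Measure _ => m A) hmeas
    simpa using this
  rw [eventuallyConst_set']
  rcases eq_or_ne (ν A) 0 with h0 | h0
  · exact Or.inl (ae_eq_empty.2 h0)
  · refine Or.inr (ae_eq_univ.2 ((prob_compl_eq_zero_iff hA).2 ?_))
    rw [← hA1] at hA2
    exact (ENNReal.mul_eq_left h0 (measure_ne_top ν A)).1 hA2.symm

end Ergodicity

/-! ### The strong law of large numbers for Markov chains -/

section StrongLaw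

variable {S : Type*} [Countable S]

/-- **Ergodic theorem for Markov chains** on a countable state space. -/
theorem IsMarkovChain.ae_tendsto {K : S → PMF S} {p : PMF S} (hpos : ∀ s, 0 < p s)
    (hp : p.bind K = p) (hirr : IsIrreducible K) {Ω : Type*} [MeasurableSpace Ω]
    {μ : Measure Ω} [IsProbabilityMeasure μ] {x₀ : S} {X : ℕ → Ω → S}
    (hX : IsMarkovChain μ K x₀ X) {φ : S → ℝ} (hφ : Summable fun s => φ s * (p s).toReal) :
    ∀ᵐ ω ∂μ, Tendsto (fun N : ℕ => (1 / (N : ℝ)) * ∑ k ∈ Finset.range N, φ (X k ω))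
      atTop (𝓝 (∑' s, φ s * (p s).toReal)) := by
  let _ : MeasurableSpace S := ⊤
  have : DiscreteMeasurableSpace S := ⟨fun _ => trivial⟩
  obtain ⟨ν, hν, hlaw⟩ := exists_isPathLaw K p
  have herg := hlaw.ergodic hpos hp hirr
  have hXm : Measurable fun ω k => X k ω :=
    measurable_pi_lambda _ fun k => measurable_to_countable' fun s => hX.measurable k s
  have h0 : Measurable fun x : ℕ → S => x 0 := measurable_pi_apply 0
  have hstart : ν.map (fun x : ℕ → S => x 0) = p.toMeasure := by
    refine Measure.ext_of_singleton fun s => ?_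
    rw [Measure.map_apply h0 (measurableSet_singleton s),
      PMF.toMeasure_apply_singleton _ _ (measurableSet_singleton s)]
    exact hlaw.initial s
  have hφm : Measurable φ := measurable_of_countable φ
  have hφp : Integrable φ p.toMeasure := by
    refine ⟨hφm.aestronglyMeasurable, ?_⟩
    rw [hasFiniteIntegral_iff_enorm, lintegral_countable']
    simp_rw [PMF.toMeasure_apply_singleton _ _ (measurableSet_singleton _)]
    have : ∀ s, ‖φ s‖ₑ * p s = ENNReal.ofReal ‖φ s * (p s).toReal‖ := by
      intro s
      rw [norm_mul, ENNReal.ofReal_mul (norm_nonneg _), ofReal_norm, Real.norm_of_nonneg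
        ENNReal.toReal_nonneg, ENNReal.ofReal_toReal (p.apply_ne_top s)]
    simp_rw [this]
    rw [← ENNReal.ofReal_tsum_of_nonneg (fun _ => norm_nonneg _) hφ.norm]
    exact ENNReal.ofReal_lt_top
  have hφν : Integrable (fun x : ℕ → S => φ (x 0)) ν := by
    rw [← hstart] at hφp
    exact hφp.comp_measurable h0
  have hintegral : ∫ x, φ (x 0) ∂ν = ∑' s, φ s * (p s).toReal := by
    rw [← integral_map (φ := fun x : ℕ → S => x 0) h0.aemeasurable hφm.aestronglyMeasurable,
      hstart, PMF.integral_eq_tsum _ _ hφp]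
    simp_rw [smul_eq_mul, mul_comm]
  have hconv := ae_tendsto_birkhoffAverage herg (hφm.comp h0) hφν
  have hshift : ∀ (k : ℕ) (x : ℕ → S), (pathShift^[k] x) 0 = x k := by
    intro k
    induction k with
    | zero => exact fun x => rfl
    | succ k ih => exact fun x => ih (pathShift x)
  -- Up to the factor `p x₀`, the chain from `x₀` is the stationary chain restricted to paths
  -- starting there; as `p x₀ ≠ 0`, sets null for `ν` are null for its law.
  have hmap : p x₀ • μ.map (fun ω k => X k ω) = ν.restrict (startsAt x₀) := by
    have hfin : IsFiniteMeasure (p x₀ • μ.map (fun ω k => X k ω)) :=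
      Measure.smul_finite _ (p.apply_ne_top x₀)
    refine measure_ext_of_pathCylinder fun N a => ?_
    have hc := measurableSet_pathCylinder N a
    have hlawX : IsPathLaw (μ.map fun ω k => X k ω) K (fun s => μ {ω | X 0 ω = s}) := by
      refine ⟨fun s => Measure.map_apply hXm (measurableSet_startsAt s), fun N a => ?_⟩
      rw [Measure.map_apply hXm (measurableSet_pathCylinder _ _),
        Measure.map_apply hXm (measurableSet_pathCylinder _ _)]
      exact hX.markov N a
    rw [Measure.smul_apply, hlawX.pathCylinder_eq, Measure.restrict_apply hc, smul_eq_mul]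
    by_cases ha : a 0 = x₀
    · have hone : μ {ω | X 0 ω = a 0} = 1 := by
        rw [ha]
        exact (prob_compl_eq_zero_iff (hX.measurable 0 x₀)).1 hX.initial
      rw [← ha, Set.inter_eq_left.2 (pathCylinder_subset_startsAt N a), hlaw.pathCylinder_eq,
        hone, one_mul]
    · have hzero : μ {ω | X 0 ω = a 0} = 0 := by
        refine measure_mono_null (fun ω hω => ?_) hX.initial
        exact fun h => ha (hω.symm.trans h)
      have hempty : pathCylinder N a ∩ startsAt x₀ = ∅ :=
        Set.eq_empty_of_forall_notMem fun x hx =>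
          ha ((pathCylinder_subset_startsAt N a hx.1).symm.trans hx.2)
      simp [hzero, hempty]
  have hac : μ.map (fun ω k => X k ω) ≪ ν := by
    refine Measure.AbsolutelyContinuous.mk fun B _ hB => ?_
    have h1 : (p x₀ • μ.map (fun ω k => X k ω)) B = 0 := by
      rw [hmap]
      exact Measure.restrict_le_self.absolutelyContinuous hB
    rw [Measure.smul_apply, smul_eq_mul, mul_eq_zero] at h1
    exact h1.resolve_left (hpos x₀).ne'
  filter_upwards [ae_of_ae_map hXm.aemeasurable (hac.ae_le hconv)] with ω hω
  simp only [birkhoffSum, Function.comp_apply, hshift] at hω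
  rw [← hintegral]
  exact hω

end StrongLaw

/-! ### Skew detailed balance for the lifted kernels -/

theorem flipMomentum_flipMomentum {n : ℕ} (i : Fin n) (θ : Fin n → ℤˣ) :
    flipMomentum i (flipMomentum i θ) = θ := by
  simp [flipMomentum]

theorem flipMomentum_ne {n : ℕ} (i : Fin n) (θ : Fin n → ℤˣ) : flipMomentum i θ ≠ θ := by
  intro h
  have h1 := congrFun h i
  simp only [flipMomentum, Function.update_self] at h1
  rcases Int.units_eq_one_or (θ i) with h2 | h2 <;> rw [h2] at h1 <;> revert h1 <;> decide

variable {Ξ : Type*} {n : ℕ}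

theorem involution_involution (i : Fin n) (x : ExtState Ξ n) :
    involution i (involution i x) = x := by
  simp [involution, flipMomentum_flipMomentum]

/-- The extended target as a probability distribution. -/
noncomputable def extPMF (p : PMF Ξ) : PMF (ExtState Ξ n) :=
  p.bind fun ξ => (PMF.uniformOfFintype (Fin n → ℤˣ)).map (Prod.mk ξ)

theorem extPMF_apply (p : PMF Ξ) (x : ExtState Ξ n) :
    extPMF p x = p x.1 * (2 ^ n : ℝ≥0∞)⁻¹ := by
  classical
  obtain ⟨ξ, θ⟩ := x
  have hinner : ∀ ξ', ((PMF.uniformOfFintype (Fin n → ℤˣ)).map (Prod.mk ξ')) (ξ, θ)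
      = if ξ = ξ' then (2 ^ n : ℝ≥0∞)⁻¹ else 0 := by
    intro ξ'
    rw [PMF.map_apply]
    by_cases h : ξ = ξ'
    · subst h
      rw [if_pos rfl, tsum_eq_single θ]
      · simp
      · intro θ' hθ'
        rw [if_neg]
        exact fun h => hθ' (congrArg Prod.snd h).symm
    · rw [if_neg h]
      simp [h]
  rw [extPMF, PMF.bind_apply, tsum_eq_single ξ]
  · rw [hinner, if_pos rfl]
  · intro ξ' hξ'
    rw [hinner, if_neg hξ'.symm, mul_zero]

theorem toReal_extPMF (p : PMF Ξ) (x : ExtState Ξ n) : (extPMF p x).toReal = extTarget p x := by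
  rw [extPMF_apply, extTarget, ENNReal.toReal_mul, ENNReal.toReal_inv, mul_comm]
  simp

theorem extPMF_pos {p : PMF Ξ} (hp : ∀ ξ, 0 < p ξ) (x : ExtState Ξ n) : 0 < extPMF p x := by
  rw [extPMF_apply]
  exact ENNReal.mul_pos (hp _).ne' (ENNReal.inv_ne_zero.2 (by finiteness))

namespace Flows

variable {Q : Ξ → PMF Ξ} (F : Flows Q n)

theorem weight_ne_top (ξ : Ξ) (i : Fin n) : F.weight ξ i ≠ ∞ := by
  refine ne_top_of_le_ne_top ENNReal.one_ne_top ?_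
  rw [← F.sum_weight ξ]
  exact Finset.single_le_sum (f := F.weight ξ) (fun _ _ => zero_le) (Finset.mem_univ i)

/-- The probability that the proposal of `P_i` is rejected. -/
noncomputable def rejection (p : PMF Ξ) (i : Fin n) (x : ExtState Ξ n) : ℝ≥0∞ :=
  ∑' x', F.proposal i x x' * (1 - min 1 (F.ratio p i x x'))

-- The terms are added rather than separated by cases: when the neighbourhood is empty, an accepted
-- proposal also lands on `involution i x`.
open Classical in
theorem stepKernel_apply (p : PMF Ξ) (i : Fin n) (x y : ExtState Ξ n) :
    F.stepKernel p i x y = F.proposal i x y * min 1 (F.ratio p i x y)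
      + if y = involution i x then F.rejection p i x else 0 := by
  have hcoin : ∀ x', ((coin (F.ratio p i x x')).map fun b => if b then x' else involution i x) y
      = (if y = x' then min 1 (F.ratio p i x x') else 0)
        + if y = involution i x then 1 - min 1 (F.ratio p i x x') else 0 := by
    intro x'
    rw [PMF.map_apply, tsum_fintype, Fintype.sum_bool]
    simp [coin]
  rw [stepKernel, PMF.bind_apply]
  simp_rw [hcoin, mul_add]
  rw [ENNReal.tsum_add]
  congr 1
  · rw [tsum_eq_single y]
    · rw [if_pos rfl]
    · intro x' hx'
      rw [if_neg hx'.symm, mul_zero]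
  · split_ifs
    · rfl
    · simp

/-- Skew detailed balance of `P_i` with respect to the measure `ω_i π`. -/
theorem skew_detailed_balance {p : PMF Ξ} (i : Fin n) (x y : ExtState Ξ n) :
    F.weight x.1 i * p x.1 * F.stepKernel p i x y
      = F.weight y.1 i * p y.1 * F.stepKernel p i (involution i y) (involution i x) := by
  classical
  have hfin : ∀ z : ExtState Ξ n, F.weight z.1 i * p z.1 ≠ ∞ := fun z =>
    ENNReal.mul_ne_top (F.weight_ne_top _ _) (p.apply_ne_top _)
  -- The accepted flow is a minimum of two terms that are exchanged by `(a, b) ↦ (S_i b, S_i a)`. If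
  -- `c = 0`, both sides vanish whatever the ratio.
  have hmin : ∀ a b : ExtState Ξ n,
      F.weight a.1 i * p a.1 * (F.proposal i a b * min 1 (F.ratio p i a b))
        = min (F.weight a.1 i * p a.1 * F.proposal i a b)
          (F.weight b.1 i * p b.1 * F.proposal i (involution i b) (involution i a)) := by
    intro a b
    rw [← mul_assoc, ratio]
    set c := F.weight a.1 i * p a.1 * F.proposal i a b with hc
    rcases eq_or_ne c 0 with h0 | h0
    · simp [h0]
    · have htop : c ≠ ∞ := ENNReal.mul_ne_top (hfin a) (PMF.apply_ne_top _ _)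
      rw [mul_min, mul_one, ENNReal.mul_div_cancel h0 htop]
  rw [stepKernel_apply, stepKernel_apply, mul_add, mul_add, hmin]
  have h2 := hmin (involution i y) (involution i x)
  simp only [involution_involution] at h2
  change F.weight y.1 i * p y.1 * _ = min (F.weight y.1 i * p y.1 * _)
    (F.weight x.1 i * p x.1 * _) at h2
  rw [h2, min_comm, involution_involution]
  congr 1
  -- Rejection contributes only when `y = S_i x`; then `S_i y = x`, and both sides contain the same
  -- rejection probability at the same position.
  by_cases hy : y = involution i x
  · subst hy
    rw [involution_involution, if_pos rfl]
    rfl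
  · rw [if_neg hy, if_neg, mul_zero, mul_zero]
    intro h
    exact hy h.symm

theorem chainKernel_apply (p : PMF Ξ) (x y : ExtState Ξ n) :
    F.chainKernel p x y = ∑ i, F.weight x.1 i * F.stepKernel p i x y := by
  rw [chainKernel, PMF.bind_apply, tsum_fintype]
  rfl

/-- The extended target is invariant for the lifted chain. -/
theorem extPMF_bind_chainKernel (p : PMF Ξ) :
    (extPMF p).bind (F.chainKernel p) = extPMF p := by
  ext y
  rw [PMF.bind_apply]
  simp_rw [chainKernel_apply, Finset.mul_sum]
  rw [Summable.tsum_finsetSum fun _ _ => ENNReal.summable]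
  have hi : ∀ i, ∑' x, extPMF p x * (F.weight x.1 i * F.stepKernel p i x y)
      = extPMF p y * F.weight y.1 i := by
    intro i
    let e : ExtState Ξ n ≃ ExtState Ξ n :=
      ⟨involution i, involution i, involution_involution i, involution_involution i⟩
    -- `S_i` permutes the states, so this is the total mass of `P_i(S_i y, ·)`.
    have hsum : ∑' x, F.stepKernel p i (involution i y) (involution i x) = 1 :=
      (e.tsum_eq (F.stepKernel p i (involution i y))).trans (PMF.tsum_coe _)
    have hterm : ∀ x, extPMF p x * (F.weight x.1 i * F.stepKernel p i x y)
        = extPMF p y * F.weight y.1 i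
          * F.stepKernel p i (involution i y) (involution i x) := by
      intro x
      have := F.skew_detailed_balance (p := p) i x y
      rw [extPMF_apply, extPMF_apply]
      calc _ = (2 ^ n : ℝ≥0∞)⁻¹ * (F.weight x.1 i * p x.1 * F.stepKernel p i x y) := by ring
        _ = _ := by rw [this]; ring
    simp_rw [hterm]
    rw [ENNReal.tsum_mul_left, hsum, mul_one]
  simp_rw [hi]
  rw [← Finset.mul_sum, F.sum_weight, mul_one]

/-! ### Irreducibility of the lifted chain -/

theorem pos_of_mem_nbhd {i : Fin n} {s : ℤˣ} {ξ ξ' : Ξ} (h : ξ' ∈ F.nbhd i s ξ) :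
    0 < Q ξ ξ' := by
  have h1 : (ξ, ξ') ∈ F.E i ∪ reverseEdges (F.E i) := by
    unfold nbhd at h
    split_ifs at h
    · exact Or.inl h
    · exact Or.inr h
  have h2 : (ξ, ξ') ∈ {e : Ξ × Ξ | 0 < Q e.1 e.2} := by
    rw [← F.cover_edges]
    exact Set.mem_iUnion.2 ⟨i, h1⟩
  exact h2

theorem mem_nbhd_neg {i : Fin n} {s : ℤˣ} {ξ ξ' : Ξ} (h : ξ' ∈ F.nbhd i s ξ) :
    ξ ∈ F.nbhd i (-s) ξ' := by
  have hne : (-1 : ℤˣ) ≠ 1 := by decide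
  rcases Int.units_eq_one_or s with rfl | rfl
  · rw [nbhd, if_pos rfl] at h
    rw [nbhd, if_neg hne]
    exact h
  · rw [nbhd, if_neg hne] at h
    rw [nbhd, if_pos (neg_neg _)]
    exact h

theorem active_of_mem_nbhd {i : Fin n} {s : ℤˣ} {ξ ξ' : Ξ} (h : ξ' ∈ F.nbhd i s ξ) :
    F.Active ξ i := by
  have hpos : (Q ξ).toOuterMeasure (F.nbhd i s ξ) ≠ 0 := by
    rw [Ne, PMF.toOuterMeasure_apply_eq_zero_iff]
    exact Set.not_disjoint_iff.2
      ⟨ξ', (PMF.mem_support_iff _ _).2 (F.pos_of_mem_nbhd h).ne', h⟩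
  rw [Active, pos_iff_ne_zero, weight, Ne, add_eq_zero]
  rintro ⟨h1, h2⟩
  rcases Int.units_eq_one_or s with rfl | rfl
  · exact hpos h1
  · exact hpos h2

theorem exists_mem_nbhd {ξ ξ' : Ξ} (h : 0 < Q ξ ξ') : ∃ i s, ξ' ∈ F.nbhd i s ξ := by
  have h1 : (ξ, ξ') ∈ ⋃ i, (F.E i ∪ reverseEdges (F.E i)) := by
    rw [F.cover_edges]
    exact h
  obtain ⟨i, hi | hi⟩ := Set.mem_iUnion.1 h1
  · exact ⟨i, 1, by rw [nbhd, if_pos rfl]; exact hi⟩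
  · exact ⟨i, -1, by rw [nbhd, if_neg (by decide)]; exact hi⟩

theorem proposal_ne_zero {i : Fin n} {ξ ξ' : Ξ} {θ : Fin n → ℤˣ}
    (h : ξ' ∈ F.nbhd i (θ i) ξ) : F.proposal i (ξ, θ) (ξ', θ) ≠ 0 := by
  rw [proposal, dif_pos ⟨ξ', h⟩, ← PMF.mem_support_iff, PMF.mem_support_map_iff]
  refine ⟨ξ', (PMF.mem_support_filter_iff _).2 ⟨h, ?_⟩, rfl⟩
  exact (PMF.mem_support_iff _ _).2 (F.pos_of_mem_nbhd h).ne'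

theorem momentum_eq_or_eq_involution_of_proposal_ne_zero {i : Fin n} {x y : ExtState Ξ n}
    (h : F.proposal i x y ≠ 0) : y.2 = x.2 ∨ y = involution i x := by
  rw [← PMF.mem_support_iff, proposal] at h
  split_ifs at h
  · obtain ⟨ξ', -, rfl⟩ := (PMF.mem_support_map_iff _ _ _).1 h
    exact Or.inl rfl
  · exact Or.inr (by simpa using h)

/-- This dichotomy allows a `P_i`-path to be cut at its first change of momentum. -/
theorem momentum_eq_or_eq_involution {p : PMF Ξ} {i : Fin n} {x y : ExtState Ξ n}
    (h : 0 < F.stepKernel p i x y) : y.2 = x.2 ∨ y = involution i x := by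
  classical
  rw [stepKernel_apply] at h
  by_cases hy : y = involution i x
  · exact Or.inr hy
  · rw [if_neg hy, add_zero] at h
    exact F.momentum_eq_or_eq_involution_of_proposal_ne_zero (left_ne_zero_of_mul h.ne')

/-- The reversed edge belongs to the same flow with the opposite sign, so the numerator of the
acceptance ratio is nonzero. -/
theorem stepKernel_pos {p : PMF Ξ} (hp : ∀ ξ, 0 < p ξ) {i : Fin n} {ξ ξ' : Ξ}
    {θ : Fin n → ℤˣ} (h : ξ' ∈ F.nbhd i (θ i) ξ) : 0 < F.stepKernel p i (ξ, θ) (ξ', θ) := by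
  classical
  rw [stepKernel_apply]
  refine lt_of_lt_of_le ?_ le_self_add
  have hback : ξ ∈ F.nbhd i (flipMomentum i θ i) ξ' := by
    simpa [flipMomentum] using F.mem_nbhd_neg h
  refine ENNReal.mul_pos (F.proposal_ne_zero h) (lt_min one_pos (ENNReal.div_pos ?_ ?_)).ne'
  · exact mul_ne_zero (mul_ne_zero (F.active_of_mem_nbhd hback).ne' (hp _).ne')
      (F.proposal_ne_zero hback)
  · exact ENNReal.mul_ne_top (ENNReal.mul_ne_top (F.weight_ne_top _ _) (p.apply_ne_top _))
      (PMF.apply_ne_top _ _)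

theorem chainKernel_pos {p : PMF Ξ} {i : Fin n} {x y : ExtState Ξ n} (hi : F.Active x.1 i)
    (h : 0 < F.stepKernel p i x y) : 0 < F.chainKernel p x y := by
  rw [chainKernel_apply]
  exact lt_of_lt_of_le (ENNReal.mul_pos hi.ne' h.ne')
    (Finset.single_le_sum (f := fun j => F.weight x.1 j * F.stepKernel p j x y)
      (fun _ _ => zero_le) (Finset.mem_univ i))

/-- Read off from skew detailed balance: positivity of one side forces every factor of the other to
be positive. -/
theorem stepKernel_skew_pos {p : PMF Ξ} (hp : ∀ ξ, 0 < p ξ) {i : Fin n} {x y : ExtState Ξ n}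
    (hi : F.Active x.1 i) (h : 0 < F.stepKernel p i x y) :
    F.Active y.1 i ∧ 0 < F.stepKernel p i (involution i y) (involution i x) := by
  have h1 : F.weight x.1 i * p x.1 * F.stepKernel p i x y ≠ 0 :=
    mul_ne_zero (mul_ne_zero hi.ne' (hp _).ne') h.ne'
  rw [F.skew_detailed_balance] at h1
  exact ⟨pos_iff_ne_zero.2 (left_ne_zero_of_mul (left_ne_zero_of_mul h1)),
    pos_iff_ne_zero.2 (right_ne_zero_of_mul h1)⟩

/-- The lifted chain can move from `x` to `y`. -/
def Reaches (p : PMF Ξ) (x y : ExtState Ξ n) : Prop :=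
  Relation.ReflTransGen (fun a b => 0 < F.chainKernel p a b) x y

/-- Active momentum components can be flipped in place. -/
theorem reaches_involution {p : PMF Ξ} (hp : ∀ ξ, 0 < p ξ) (hflip : F.Flippable p)
    {i : Fin n} {x : ExtState Ξ n} (hi : F.Active x.1 i) : F.Reaches p x (involution i x) := by
  -- While the momentum is unchanged, the induction carries a return route from `S_i y` to `S_i x`;
  -- the first application of `S_i` joins the outward path to it.
  have key : ∀ y, Relation.ReflTransGen (fun a b => 0 < F.stepKernel p i a b) x y →
      F.Reaches p x (involution i x) ∨ (y.2 = x.2 ∧ F.Active y.1 i ∧ F.Reaches p x y ∧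
        F.Reaches p (involution i y) (involution i x)) := by
    intro y hy
    induction hy with
    | refl => exact Or.inr ⟨rfl, hi, .refl, .refl⟩
    | @tail y z _ hyz ih =>
      rcases ih with ih | ⟨h2, hact, hto, hback⟩
      · exact Or.inl ih
      · rcases F.momentum_eq_or_eq_involution hyz with hz | rfl
        · obtain ⟨hactz, hskew⟩ := F.stepKernel_skew_pos hp hact hyz
          refine Or.inr ⟨hz.trans h2, hactz, hto.tail (F.chainKernel_pos hact hyz), ?_⟩
          exact .head (F.chainKernel_pos (x := involution i z) hactz hskew) hback
        · exact Or.inl ((hto.tail (F.chainKernel_pos hact hyz)).trans hback)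
  obtain ⟨m, ξ', hm⟩ := hflip x.1 x.2 i hi
  rcases key _ (reflTransGen_of_kernelPow_pos hm) with h | ⟨h, -⟩
  · exact h
  · exact absurd h (flipMomentum_ne i x.2)

/-- If `θ i` opposes the orientation of the edge, flip it, cross, and flip back; `i` is active at
both ends of the edge. -/
theorem reaches_of_proposal_pos {p : PMF Ξ} (hp : ∀ ξ, 0 < p ξ) (hflip : F.Flippable p)
    {ξ ξ' : Ξ} (h : 0 < Q ξ ξ') (θ : Fin n → ℤˣ) : F.Reaches p (ξ, θ) (ξ', θ) := by
  obtain ⟨i, s, hs⟩ := F.exists_mem_nbhd h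
  have hact := F.active_of_mem_nbhd hs
  have hact' := F.active_of_mem_nbhd (F.mem_nbhd_neg hs)
  by_cases hθ : θ i = s
  · subst hθ
    exact .single (F.chainKernel_pos hact (F.stepKernel_pos hp hs))
  · have hs' : ξ' ∈ F.nbhd i (flipMomentum i θ i) ξ := by
      have : flipMomentum i θ i = s := by
        rw [flipMomentum, Function.update_self, Int.units_ne_iff_eq_neg.1 hθ, neg_neg]
      rwa [this]
    have h1 := F.reaches_involution hp hflip (x := (ξ, θ)) hact
    have h2 := F.reaches_involution hp hflip (x := (ξ', flipMomentum i θ)) hact'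
    rw [involution, flipMomentum_flipMomentum] at h2
    exact (h1.tail (F.chainKernel_pos (x := involution i (ξ, θ)) hact
      (F.stepKernel_pos hp hs'))).trans h2

theorem reaches_position {p : PMF Ξ} (hadm : Admissible Q p) (hflip : F.Flippable p)
    (ξ ξ' : Ξ) (θ : Fin n → ℤˣ) : F.Reaches p (ξ, θ) (ξ', θ) := by
  obtain ⟨m, hm⟩ := hadm.irreducible ξ ξ'
  have h := reflTransGen_of_kernelPow_pos hm
  clear hm
  induction h with
  | refl => exact .refl
  | tail _ hstep ih => exact ih.trans (F.reaches_of_proposal_pos hadm.pos hflip hstep θ)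

/-- As `i` may be inactive at `ξ`, the flip is made at an endpoint of some edge of flow `i`, between
a walk there and a walk back. -/
theorem reaches_flipMomentum {p : PMF Ξ} (hadm : Admissible Q p) (hflip : F.Flippable p)
    (ξ : Ξ) (θ : Fin n → ℤˣ) (i : Fin n) : F.Reaches p (ξ, θ) (ξ, flipMomentum i θ) := by
  obtain ⟨⟨u, v⟩, huv⟩ := F.edge_nonempty i
  have hact : F.Active u i := F.active_of_mem_nbhd (s := 1) (ξ' := v) (by
    rw [nbhd, if_pos rfl]
    exact huv)
  exact ((F.reaches_position hadm hflip ξ u θ).trans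
    (F.reaches_involution hadm.pos hflip (x := (u, θ)) hact)).trans
    (F.reaches_position hadm hflip u ξ _)

theorem reaches_momentum {p : PMF Ξ} (hadm : Admissible Q p) (hflip : F.Flippable p)
    (ξ : Ξ) (θ θ' : Fin n → ℤˣ) : F.Reaches p (ξ, θ) (ξ, θ') := by
  have key : ∀ s : Finset (Fin n), F.Reaches p (ξ, θ) (ξ, s.piecewise θ' θ) := by
    intro s
    induction s using Finset.induction_on with
    | empty => rw [Finset.piecewise_empty]; exact .refl
    | insert j s _ ih =>
      rw [Finset.piecewise_insert]
      by_cases hj : θ' j = s.piecewise θ' θ j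
      · rwa [hj, Function.update_eq_self]
      · rw [Int.units_ne_iff_eq_neg.1 hj]
        exact ih.trans (F.reaches_flipMomentum hadm hflip ξ _ j)
  simpa using key Finset.univ

/-- The lifted chain is irreducible. -/
theorem isIrreducible_chainKernel {p : PMF Ξ} (hadm : Admissible Q p) (hflip : F.Flippable p) :
    IsIrreducible (F.chainKernel p) := fun x x' =>
  exists_kernelPow_pos ((F.reaches_position hadm hflip x.1 x'.1 x.2).trans
    (F.reaches_momentum hadm hflip x'.1 x.2 x'.2))

end Flows

end LiftedFlow

theorem theorem4p5 {Ξ : Type*} [Countable Ξ] {n : ℕ}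
    (Q : Ξ → PMF Ξ) (p : PMF Ξ) (F : LiftedFlow.Flows Q n)
    (hadm : LiftedFlow.Admissible Q p) (hflip : F.Flippable p) :
    LiftedFlow.IsIrreducible (F.chainKernel p) ∧
    ∀ {Ω : Type*} [MeasurableSpace Ω] (μ : MeasureTheory.Measure Ω)
      [MeasureTheory.IsProbabilityMeasure μ]
      (x₀ : LiftedFlow.ExtState Ξ n) (X : ℕ → Ω → LiftedFlow.ExtState Ξ n),
      LiftedFlow.IsMarkovChain μ (F.chainKernel p) x₀ X →
      (∀ x' : LiftedFlow.ExtState Ξ n, ∀ᵐ ω ∂μ,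
        Filter.Tendsto
          (fun N : ℕ => (1 / (N : ℝ)) *
            ∑ k ∈ Finset.range N, Set.indicator {x'} (fun _ => (1 : ℝ)) (X k ω))
          Filter.atTop (nhds (LiftedFlow.extTarget p x'))) ∧
      (∀ φ : LiftedFlow.ExtState Ξ n → ℝ,
        Summable (fun x => φ x * LiftedFlow.extTarget p x) →
        ∀ᵐ ω ∂μ, Filter.Tendsto
          (fun N : ℕ => (1 / (N : ℝ)) * ∑ k ∈ Finset.range N, φ (X k ω))
          Filter.atTop (nhds (∑' x, φ x * LiftedFlow.extTarget p x))) := by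
  have hirr := F.isIrreducible_chainKernel hadm hflip
  refine ⟨hirr, fun {Ω} _ μ _ x₀ X hX => ?_⟩
  have hlaw : ∀ φ : LiftedFlow.ExtState Ξ n → ℝ,
      Summable (fun x => φ x * LiftedFlow.extTarget p x) →
      ∀ᵐ ω ∂μ, Filter.Tendsto
        (fun N : ℕ => (1 / (N : ℝ)) * ∑ k ∈ Finset.range N, φ (X k ω))
        Filter.atTop (nhds (∑' x, φ x * LiftedFlow.extTarget p x)) := by
    intro φ hφ
    have h := hX.ae_tendsto (LiftedFlow.extPMF_pos hadm.pos) (F.extPMF_bind_chainKernel p) hirr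
      (φ := φ)
    simp_rw [LiftedFlow.toReal_extPMF] at h
    exact h hφ
  refine ⟨fun x' => ?_, hlaw⟩
  -- Visit frequencies are the case of the indicator of a point, whose series has a single possibly
  -- nonzero term.
  have hzero : ∀ x, x ≠ x' →
      Set.indicator {x'} (fun _ => (1 : ℝ)) x * LiftedFlow.extTarget p x = 0 := by
    intro x hx
    rw [Set.indicator_of_notMem (by simpa using hx), zero_mul]
  have h := hlaw (Set.indicator {x'} fun _ => (1 : ℝ)) (summable_of_ne_finset_zero (s := {x'})
    fun x hx => hzero x (by simpa using hx))
  rw [tsum_eq_single x' hzero, Set.indicator_of_mem (Set.mem_singleton x'), one_mul] at h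
  exact h
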